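/- Let $n\ge 1$ and let $\Omega=D_1\times\cdots\times D_n\subset\mathbb C^n$, where each $D_j\subset\mathbb C$ is a bounded domain (nonempty, open, connected). Let $0<\alpha_j<2$ for $j=1,\dots,n$ and $1<p<\infty$. For a measurable weight $\mu:\mathbb C^n\to[0,\infty)$ that is not almost everywhere zero, put $$A_p^*(\mu)=\sup\Big(\frac1{|D|}\int_D\mu(z)\,dV_{z_j}\Big)\Big(\frac1{|D|}\int_D\mu(z)^{\frac1{1-p}}\,dV_{z_j}\Big)^{p-1},$$ where the supremum is taken over $j=1,\dots,n$, almost every $(z_1,\dots,z_{j-1},z_{j+1},\dots,z_n)\in\mathbb C^{n-1}$ and all discs $D\subset\mathbb C$ (an essential supremum in the frozen variables), with values in $[0,\infty]$ and the conventions $0^{1/(1-p)}=\infty$, $0\cdot\infty=0$. Write $\mu\in A_p^*$ if $A_p^*(\mu)<\infty$, and let $L^p(\Omega,\mu)$ be the space of measurable functions $f:\Omega\to\mathbb C$ with $$\|f\|_{L^p(\Omega,\mu)}=\Big(\int_\Omega|f(z)|^p\mu(z)\,dV_z\Big)^{1/p}<\infty .$$ Then for every $\mu\in A_p^*$ the Riesz-type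 integral $$R_\alpha f(z)=\int_\Omega\frac{f(\zeta)}{\prod_{j=1}^n|\zeta_j-z_j|^{\alpha_j}}\,dV_\zeta$$ defines a bounded operator from $L^p(\Omega,\mu)$ into itself: for every $f\in L^p(\Omega,\mu)$ the integral converges absolutely for almost every $z\in\Omega$, $R_\alpha f\in L^p(\Omega,\mu)$, and $$\|R_\alpha f\|_{L^p(\Omega,\mu)}\le C\,\|f\|_{L^p(\Omega,\mu)} .$$ Here the constant $C$ depends only on $\Omega$, $\alpha$, $p$ and an upper bound for $A_p^*(\mu)$. -/

import Mathlib

open MeasureTheory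
open scoped NNReal ENNReal

noncomputable section

/-- The Muckenhoupt quantity of a one-variable weight `v` on the disc of centre `c` and radius `r`:
`(⨍_D v) * (⨍_D v ^ (1 / (1 - p))) ^ (p - 1)`, computed in `[0, ∞]`
(so `v ^ (1 / (1 - p)) = ∞` where `v = 0`). -/
def discApQuantity (p : ℝ) (v : ℂ → ℝ≥0) (c : ℂ) (r : ℝ) : ℝ≥0∞ :=
  (⨍⁻ w in Metric.ball c r, (v w : ℝ≥0∞) ∂volume) *
    (⨍⁻ w in Metric.ball c r, (v w : ℝ≥0∞) ^ (1 / (1 - p)) ∂volume) ^ (p - 1)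

/-- The one-variable slice of `μ` in the `j`-th variable, the other variables being frozen
at `zhat`. -/
def weightSlice {n : ℕ} (μ : (Fin (n + 1) → ℂ) → ℝ≥0) (j : Fin (n + 1)) (zhat : Fin n → ℂ) :
    ℂ → ℝ≥0 :=
  fun w => μ (Fin.insertNth (α := fun _ => ℂ) j w zhat)

/-- The `A_p^*` constant of a weight on `ℂ^(n+1)`: the supremum over all coordinates `j`, almost
every `zhat` in `ℂ^n` and all discs in `ℂ`. -/
def apStarConst {n : ℕ} (p : ℝ) (μ : (Fin (n + 1) → ℂ) → ℝ≥0) : ℝ≥0∞ :=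
  ⨆ j : Fin (n + 1),
    essSup (fun zhat : Fin n → ℂ =>
      ⨆ (c : ℂ) (r : ℝ) (_ : 0 < r), discApQuantity p (weightSlice μ j zhat) c r) volume

/-- The class `A_p^*`: Lebesgue measurable weights with finite `A_p^*` constant. In `[0, ∞]` the
product `0 * ∞` is `0`, so the weight that vanishes almost everywhere has to be excluded. -/
structure MemApStar {n : ℕ} (p : ℝ) (μ : (Fin (n + 1) → ℂ) → ℝ≥0) : Prop where
  aemeasurable : AEMeasurable μ volume
  not_ae_zero : ¬ (μ =ᵐ[volume] 0)
  const_lt_top : apStarConst p μ < ∞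

/-- The measure `μ dV` on `Ω`; thus `L^p(Ω, μ)` is the `L^p` space of `weightedVolume Ω μ`. -/
def weightedVolume {n : ℕ} (Ω : Set (Fin n → ℂ)) (μ : (Fin n → ℂ) → ℝ≥0) :
    Measure (Fin n → ℂ) :=
  (volume.restrict Ω).withDensity (fun z => (μ z : ℝ≥0∞))

/-- The integrand `f(ζ) / ∏_j |ζ_j - z_j| ^ α_j` of the Riesz-type integral. -/
def rieszIntegrand {n : ℕ} (α : Fin n → ℝ) (f : (Fin n → ℂ) → ℂ) (z ζ : Fin n → ℂ) : ℂ :=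
  f ζ / ((∏ j, ‖ζ j - z j‖ ^ α j : ℝ) : ℂ)

/-- The Riesz-type integral `R_α f(z)` over `Ω`. -/
def rieszIntegral {n : ℕ} (Ω : Set (Fin n → ℂ)) (α : Fin n → ℝ) (f : (Fin n → ℂ) → ℂ)
    (z : Fin n → ℂ) : ℂ :=
  ∫ ζ in Ω, rieszIntegrand α f z ζ

end

/-! On a bounded set the kernel `∏ |ζ_j - z_j| ^ (-α_j)` is dominated by a product of one-variable
kernels, each a dyadic sum of disc averages. By Hölder's inequality, the `A_p` condition and
Tonelli's theorem, the unnormalized average over discs of radius `r` is bounded on `L^p(v)` with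
norm at most `[v]_{A_p} ^ (1 / p)` times the area of a disc of radius `2r`. Since `α_j < 2`, the
dyadic sum of these norms is geometric. For `μ ∈ A_p^*` these bounds hold on almost every slice,
with a constant independent of the slice, so the one-variable operators may be applied one after
the other.

It remains to see that `μ > 0` almost everywhere. On almost every slice `μ` vanishes almost
everywhere or almost nowhere, because the `A_p` quantity of large discs is finite. So the zero set
of `μ` is, up to null sets, invariant under translations along every axis, hence under all
translations, and therefore null or conull.
-/

section Averages

variable {X : Type*}

theorem lintegral_rpow_le_mul_lintegral_rpow [MeasurableSpace X] {m : Measure X} {p : ℝ}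
    (hp : 1 < p) {v : X → ℝ≥0} (hv : AEMeasurable v m) (hv0 : ∀ᵐ x ∂m, v x ≠ 0)
    {g : X → ℝ≥0∞} (hg : AEMeasurable g m) :
    (∫⁻ x, g x ∂m) ^ p ≤ (∫⁻ x, g x ^ p * v x ∂m) *
      (∫⁻ x, (v x : ℝ≥0∞) ^ (1 / (1 - p)) ∂m) ^ (p - 1) := by
  have hp0 : 0 < p := by linarith
  have hp1 : p - 1 ≠ 0 := by linarith
  have hp1' : 1 - p ≠ 0 := by linarith
  have factor : ∫⁻ x, g x ∂m =
      ∫⁻ x, g x * (v x : ℝ≥0∞) ^ (1 / p) * (v x : ℝ≥0∞) ^ (-(1 / p)) ∂m := by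
    refine lintegral_congr_ae ?_
    filter_upwards [hv0] with x hx
    rw [mul_assoc, ← ENNReal.rpow_add _ _ (mod_cast hx) ENNReal.coe_ne_top, add_neg_cancel,
      ENNReal.rpow_zero, mul_one]
  have left_rpow (x : X) : (g x * (v x : ℝ≥0∞) ^ (1 / p)) ^ p = g x ^ p * v x := by
    rw [ENNReal.mul_rpow_of_nonneg _ _ hp0.le, ← ENNReal.rpow_mul, one_div_mul_cancel hp0.ne',
      ENNReal.rpow_one]
  have right_rpow (x : X) : ((v x : ℝ≥0∞) ^ (-(1 / p))) ^ p.conjExponent =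
      (v x : ℝ≥0∞) ^ (1 / (1 - p)) := by
    rw [← ENNReal.rpow_mul, Real.conjExponent]
    congr 1
    field_simp
    ring
  have holder := ENNReal.lintegral_mul_le_Lp_mul_Lq m (Real.HolderConjugate.conjExponent hp)
    (f := fun x => g x * (v x : ℝ≥0∞) ^ (1 / p)) (g := fun x => (v x : ℝ≥0∞) ^ (-(1 / p)))
    (by fun_prop) (by fun_prop)
  simp only [Pi.mul_apply, ← factor, left_rpow, right_rpow] at holder
  refine (ENNReal.rpow_le_rpow holder hp0.le).trans_eq ?_
  rw [ENNReal.mul_rpow_of_nonneg _ _ hp0.le, ← ENNReal.rpow_mul, one_div_mul_cancel hp0.ne',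
    ENNReal.rpow_one, ← ENNReal.rpow_mul]
  congr 2
  rw [Real.conjExponent]
  field_simp

theorem eLpNorm'_tsum_le [MeasurableSpace X] {m : Measure X} {p : ℝ} (hp : 1 ≤ p)
    {f : ℕ → X → ℝ≥0∞} (hf : ∀ i, AEMeasurable (f i) m) :
    eLpNorm' (fun x => ∑' i, f i x) p m ≤ ∑' i, eLpNorm' (f i) p m := by
  have hp0 : 0 < p := by linarith
  have hS (N : ℕ) : AEMeasurable (∑ i ∈ Finset.range N, f i) m :=
    Finset.aemeasurable_sum _ fun i _ => hf i
  have monotone_convergence : eLpNorm' (fun x => ∑' i, f i x) p m =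
      ⨆ N, eLpNorm' (∑ i ∈ Finset.range N, f i) p m := by
    have rpow_iSup {q : ℝ} (hq : 0 < q) (u : ℕ → ℝ≥0∞) : (⨆ N, u N) ^ q = ⨆ N, u N ^ q :=
      (ENNReal.orderIsoRpow q hq).map_iSup u
    have hmono (x : X) : Monotone fun N => (∑ i ∈ Finset.range N, f i x) ^ p := fun _ _ h =>
      ENNReal.rpow_le_rpow (Finset.sum_le_sum_of_subset (Finset.range_mono h)) hp0.le
    simp only [eLpNorm', enorm_eq_self, ENNReal.tsum_eq_iSup_nat, Finset.sum_apply,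
      rpow_iSup hp0]
    rw [lintegral_iSup' (fun N => by simpa only [Finset.sum_apply] using (hS N).pow_const p)
      (.of_forall hmono), rpow_iSup (by positivity)]
  rw [monotone_convergence]
  exact iSup_le fun N => (eLpNorm'_sum_le (fun i _ => (hf i).aestronglyMeasurable) hp).trans
    (ENNReal.sum_le_tsum _)

/-- The positive integral operator with kernel `k`, with respect to the ambient volume. -/
noncomputable def kernelOperator [MeasureSpace X] (k : X → X → ℝ≥0∞) (g : X → ℝ≥0∞) (z : X) :
    ℝ≥0∞ :=
  ∫⁻ w, k z w * g w

/-- The integral operator with positive kernel `k` is bounded on `L^p(v)` with norm at most `C`.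
The inequality is between `p`-th powers of norms, so that it can be integrated over slices. -/
def IsBoundedKernel [MeasureSpace X] (p : ℝ) (v : X → ℝ≥0) (k : X → X → ℝ≥0∞) (C : ℝ≥0∞) :
    Prop :=
  ∀ ⦃g : X → ℝ≥0∞⦄, Measurable g →
    ∫⁻ z, kernelOperator k g z ^ p * v z ≤ C ^ p * ∫⁻ z, g z ^ p * v z

theorem measurable_kernelOperator [MeasureSpace X] [SFinite (volume : Measure X)]
    {k : X → X → ℝ≥0∞} (hk : Measurable (Function.uncurry k)) {g : X → ℝ≥0∞}
    (hg : Measurable g) : Measurable (kernelOperator k g) :=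
  (hk.mul (hg.comp measurable_snd)).lintegral_prod_right'

theorem kernelOperator_congr_ae [MeasureSpace X] (k : X → X → ℝ≥0∞) {g h : X → ℝ≥0∞}
    (hgh : g =ᵐ[volume] h) : kernelOperator k g = kernelOperator k h :=
  funext fun _ => lintegral_congr_ae (hgh.mono fun _ hw => congrArg _ hw)

theorem lintegral_kernelOperator_mul [MeasureSpace X] [SFinite (volume : Measure X)]
    {k : X → X → ℝ≥0∞} (hk : Measurable (Function.uncurry k)) {g u : X → ℝ≥0∞}
    (hg : Measurable g) (hu : Measurable u) :
    ∫⁻ z, kernelOperator k g z * u z = ∫⁻ w, g w * ∫⁻ z, k z w * u z := by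
  calc ∫⁻ z, kernelOperator k g z * u z = ∫⁻ z, ∫⁻ w, k z w * g w * u z :=
        lintegral_congr fun z => (lintegral_mul_const _ (hk.of_uncurry_left.mul hg)).symm
    _ = ∫⁻ w, ∫⁻ z, k z w * g w * u z :=
        lintegral_lintegral_swap
          ((hk.mul (hg.comp measurable_snd)).mul (hu.comp measurable_fst)).aemeasurable
    _ = ∫⁻ w, g w * ∫⁻ z, k z w * u z := by
        refine lintegral_congr fun w => ?_
        simp only [mul_comm (k _ w) (g w), mul_assoc]
        exact lintegral_const_mul _ (hk.of_uncurry_right.mul hu)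

theorem IsBoundedKernel.tsum [MeasureSpace X] [SFinite (volume : Measure X)] {p : ℝ}
    (hp : 1 ≤ p) {v : X → ℝ≥0} (hv : Measurable v) {k : ℕ → X → X → ℝ≥0∞} {C : ℕ → ℝ≥0∞}
    (hkm : ∀ i, Measurable (Function.uncurry (k i))) (hk : ∀ i, IsBoundedKernel p v (k i) (C i)) :
    IsBoundedKernel p v (fun z w => ∑' i, k i z w) (∑' i, C i) := by
  intro g hg
  have hp0 : 0 < p := by linarith
  set m : Measure X := volume.withDensity fun z => v z
  have lintegral_m (u : X → ℝ≥0∞) (hu : Measurable u) :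
      ∫⁻ z, u z ^ p * v z = eLpNorm' u p m ^ p := by
    rw [eLpNorm', ← ENNReal.rpow_mul, one_div_mul_cancel hp0.ne', ENNReal.rpow_one,
      lintegral_withDensity_eq_lintegral_mul _ hv.coe_nnreal_ennreal (by fun_prop)]
    simp only [Pi.mul_apply, enorm_eq_self, mul_comm]
  have hT (i : ℕ) : Measurable (kernelOperator (k i) g) := measurable_kernelOperator (hkm i) hg
  have operator_tsum : kernelOperator (fun z w => ∑' i, k i z w) g =
      fun z => ∑' i, kernelOperator (k i) g z := by
    ext z
    simp only [kernelOperator, ← ENNReal.tsum_mul_right]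
    exact lintegral_tsum fun i => ((hkm i).of_uncurry_left.mul hg).aemeasurable
  have norm_le (i : ℕ) : eLpNorm' (kernelOperator (k i) g) p m ≤ C i * eLpNorm' g p m := by
    rw [← ENNReal.rpow_le_rpow_iff hp0, ENNReal.mul_rpow_of_nonneg _ _ hp0.le,
      ← lintegral_m _ (hT i), ← lintegral_m g hg]
    exact hk i hg
  rw [operator_tsum, lintegral_m _ (Measurable.tsum hT), lintegral_m g hg,
    ← ENNReal.mul_rpow_of_nonneg _ _ hp0.le]
  gcongr
  calc eLpNorm' (fun z => ∑' i, kernelOperator (k i) g z) p m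
      ≤ ∑' i, eLpNorm' (kernelOperator (k i) g) p m :=
        eLpNorm'_tsum_le hp fun i => (hT i).aemeasurable
    _ ≤ ∑' i, C i * eLpNorm' g p m := ENNReal.tsum_le_tsum norm_le
    _ = (∑' i, C i) * eLpNorm' g p m := ENNReal.tsum_mul_right

theorem IsBoundedKernel.const_mul [MeasureSpace X] [SFinite (volume : Measure X)] {p : ℝ}
    (hp : 0 ≤ p) {v : X → ℝ≥0} (hv : Measurable v) {k : X → X → ℝ≥0∞} {C : ℝ≥0∞}
    (hkm : Measurable (Function.uncurry k)) (hk : IsBoundedKernel p v k C) (c : ℝ≥0∞) :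
    IsBoundedKernel p v (fun z w => c * k z w) (c * C) := by
  intro g hg
  have hT : Measurable (kernelOperator k g) := measurable_kernelOperator hkm hg
  have operator_const_mul (z : X) :
      kernelOperator (fun z w => c * k z w) g z = c * kernelOperator k g z := by
    simp only [kernelOperator, mul_assoc]
    exact lintegral_const_mul _ (hkm.of_uncurry_left.mul hg)
  simp only [operator_const_mul, ENNReal.mul_rpow_of_nonneg _ _ hp, mul_assoc]
  rw [lintegral_const_mul _ (by fun_prop)]
  gcongr
  exact hk hg

/-- The kernel `1_{|w - z| < r}`. -/
noncomputable def ballKernel [PseudoMetricSpace X] (r : ℝ) (z : X) : X → ℝ≥0∞ :=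
  (Metric.ball z r).indicator 1

section Ball

variable [PseudoMetricSpace X]

theorem ballKernel_comm (r : ℝ) (z w : X) : ballKernel r z w = ballKernel r w z := by
  simp only [ballKernel, Set.indicator, Metric.mem_ball, dist_comm, Pi.one_apply]

variable [MeasureSpace X]

theorem setLIntegral_ball_rpow_mul_le {q r : ℝ} (hq : 0 ≤ q) (hr : 0 ≤ r) (σ : X → ℝ≥0∞)
    {u : X → ℝ≥0∞} (hu : Measurable u) (x : X) :
    ∫⁻ z in Metric.ball x r, (∫⁻ w in Metric.ball z r, σ w) ^ q * u z ≤
      (∫⁻ w in Metric.ball x (2 * r), u w) * (∫⁻ w in Metric.ball x (2 * r), σ w) ^ q := by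
  calc ∫⁻ z in Metric.ball x r, (∫⁻ w in Metric.ball z r, σ w) ^ q * u z
      ≤ ∫⁻ z in Metric.ball x r, (∫⁻ w in Metric.ball x (2 * r), σ w) ^ q * u z := by
        refine setLIntegral_mono (by fun_prop) fun z hz => ?_
        have : Metric.ball z r ⊆ Metric.ball x (2 * r) :=
          Metric.ball_subset_ball' (by linarith [Metric.mem_ball.1 hz])
        gcongr
    _ ≤ ∫⁻ z in Metric.ball x (2 * r), (∫⁻ w in Metric.ball x (2 * r), σ w) ^ q * u z :=
        lintegral_mono_set (Metric.ball_subset_ball (by linarith))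
    _ = _ := by rw [lintegral_const_mul _ hu, mul_comm]

variable [OpensMeasurableSpace X]

theorem kernelOperator_ballKernel (r : ℝ) (g : X → ℝ≥0∞) :
    kernelOperator (ballKernel r) g = fun z => ∫⁻ w in Metric.ball z r, g w := by
  ext z
  rw [kernelOperator, ← lintegral_indicator Metric.isOpen_ball.measurableSet]
  refine lintegral_congr fun w => ?_
  by_cases hw : w ∈ Metric.ball z r <;> simp [ballKernel, hw]

variable [SecondCountableTopology X]

theorem measurable_uncurry_ballKernel (r : ℝ) :
    Measurable (Function.uncurry (ballKernel (X := X) r)) :=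
  measurable_one.indicator (measurableSet_lt (measurable_snd.dist measurable_fst) measurable_const)

theorem isBoundedKernel_ballKernel [SFinite (volume : Measure X)] {p : ℝ} (hp : 1 < p)
    {v : X → ℝ≥0} (hv : Measurable v) (hv0 : ∀ᵐ x, v x ≠ 0) {r : ℝ} (hr : 0 ≤ r) {C : ℝ≥0∞}
    (hC : ∀ x, (∫⁻ w in Metric.ball x (2 * r), (v w : ℝ≥0∞)) *
      (∫⁻ w in Metric.ball x (2 * r), (v w : ℝ≥0∞) ^ (1 / (1 - p))) ^ (p - 1) ≤ C ^ p) :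
    IsBoundedKernel p v (ballKernel r) C := by
  intro g hg
  set σ : X → ℝ≥0∞ := fun w => (v w : ℝ≥0∞) ^ (1 / (1 - p))
  set u : X → ℝ≥0∞ := fun z => kernelOperator (ballKernel r) σ z ^ (p - 1) * v z
  have hk := measurable_uncurry_ballKernel (X := X) r
  have hgv : Measurable fun w => g w ^ p * v w := by fun_prop
  have hu : Measurable u :=
    ((measurable_kernelOperator hk (by fun_prop)).pow_const _).mul hv.coe_nnreal_ennreal
  have holder (z : X) : kernelOperator (ballKernel r) g z ^ p * v z ≤
      kernelOperator (ballKernel r) (fun w => g w ^ p * v w) z * u z := by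
    simp only [kernelOperator_ballKernel, u, ← mul_assoc]
    gcongr
    exact lintegral_rpow_le_mul_lintegral_rpow hp hv.aemeasurable (ae_restrict_of_ae hv0)
      hg.aemeasurable
  have dual_bound (w : X) : ∫⁻ z, ballKernel r z w * u z ≤ C ^ p := by
    simp only [ballKernel_comm r _ w]
    change kernelOperator (ballKernel r) u w ≤ C ^ p
    simp only [kernelOperator_ballKernel, u]
    exact (setLIntegral_ball_rpow_mul_le (by linarith) hr σ hv.coe_nnreal_ennreal w).trans (hC w)
  calc ∫⁻ z, kernelOperator (ballKernel r) g z ^ p * v z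
      ≤ ∫⁻ z, kernelOperator (ballKernel r) (fun w => g w ^ p * v w) z * u z :=
        lintegral_mono holder
    _ = ∫⁻ w, g w ^ p * v w * ∫⁻ z, ballKernel r z w * u z :=
        lintegral_kernelOperator_mul hk hgv hu
    _ ≤ ∫⁻ w, g w ^ p * v w * C ^ p := by gcongr with w; exact dual_bound w
    _ = C ^ p * ∫⁻ w, g w ^ p * v w := by rw [lintegral_mul_const _ hgv, mul_comm]

end Ball

end Averages

section OneVariable

/-- The `A_p` constant of a one-variable weight, taken over all discs of the plane. -/
noncomputable def discApConst (p : ℝ) (v : ℂ → ℝ≥0) : ℝ≥0∞ :=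
  ⨆ (c : ℂ) (r : ℝ) (_ : 0 < r), discApQuantity p v c r

theorem setLIntegral_mul_setLIntegral_rpow_le {p : ℝ} (hp : 1 ≤ p) (v : ℂ → ℝ≥0) (c : ℂ) {r : ℝ}
    (hr : 0 < r) :
    (∫⁻ w in Metric.ball c r, (v w : ℝ≥0∞)) *
      (∫⁻ w in Metric.ball c r, (v w : ℝ≥0∞) ^ (1 / (1 - p))) ^ (p - 1) ≤
      discApConst p v * volume (Metric.ball c r) ^ p := by
  set V := volume (Metric.ball c r)
  have hV0 : V ≠ 0 := (Metric.measure_ball_pos _ _ hr).ne'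
  have hVt : V ≠ ∞ := measure_ball_lt_top.ne
  have hp1 : 0 ≤ p - 1 := by linarith
  have lintegral_eq (u : ℂ → ℝ≥0∞) :
      ∫⁻ w in Metric.ball c r, u w = V * ⨍⁻ w in Metric.ball c r, u w ∂volume := by
    rw [setLAverage_eq, ENNReal.mul_div_cancel hV0 hVt]
  have hVp : V ^ p = V * V ^ (p - 1) := by
    simpa using ENNReal.rpow_add_of_nonneg (x := V) 1 (p - 1) zero_le_one hp1
  calc _ = discApQuantity p v c r * V ^ p := by
        rw [lintegral_eq, lintegral_eq, ENNReal.mul_rpow_of_nonneg _ _ hp1, hVp, discApQuantity]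
        ring
    _ ≤ discApConst p v * V ^ p := by
        gcongr
        exact le_iSup₂_of_le c r (le_iSup_of_le hr le_rfl)

theorem ae_eq_zero_or_ae_ne_zero_of_mul_ne_top {X : Type*} [MeasurableSpace X] {m : Measure X}
    {p : ℝ} (hp : 1 < p) {v : X → ℝ≥0} (hv : Measurable v)
    (h : (∫⁻ x, (v x : ℝ≥0∞) ∂m) * (∫⁻ x, (v x : ℝ≥0∞) ^ (1 / (1 - p)) ∂m) ^ (p - 1) ≠ ∞) :
    (∀ᵐ x ∂m, v x = 0) ∨ ∀ᵐ x ∂m, v x ≠ 0 := by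
  rcases eq_or_ne (∫⁻ x, (v x : ℝ≥0∞) ∂m) 0 with h0 | h0
  · left
    filter_upwards [(lintegral_eq_zero_iff hv.coe_nnreal_ennreal).1 h0] with x hx
    simpa using hx
  · right
    have dual_ne_top : ∫⁻ x, (v x : ℝ≥0∞) ^ (1 / (1 - p)) ∂m ≠ ∞ := fun htop => h <| by
      rw [htop, ENNReal.top_rpow_of_pos (by linarith), ENNReal.mul_top h0]
    filter_upwards [ae_lt_top (by fun_prop) dual_ne_top] with x hx hx0
    have : 1 / (1 - p) < 0 := one_div_neg.2 (by linarith)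
    rw [hx0, ENNReal.coe_zero, ENNReal.zero_rpow_of_neg this] at hx
    exact hx.ne rfl

theorem ae_eq_zero_or_ae_ne_zero_of_forall_ball {X M : Type*} [PseudoMetricSpace X]
    [MeasurableSpace X] [Zero M] {m : Measure X} (v : X → M) (c : X)
    (h : ∀ r > 0, (∀ᵐ x ∂m.restrict (Metric.ball c r), v x = 0) ∨
      ∀ᵐ x ∂m.restrict (Metric.ball c r), v x ≠ 0) :
    (∀ᵐ x ∂m, v x = 0) ∨ ∀ᵐ x ∂m, v x ≠ 0 := by
  have ae_of_balls (P : X → Prop) :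
      (∀ n : ℕ, ∀ᵐ x ∂m.restrict (Metric.ball c (n + 1)), P x) → ∀ᵐ x ∂m, P x := by
    rw [← ae_restrict_iUnion_iff, Metric.iUnion_ball_nat_succ, Measure.restrict_univ]
    exact id
  have mono {P : X → Prop} {k n : ℕ} (hkn : k ≤ n)
      (hn : ∀ᵐ x ∂m.restrict (Metric.ball c (n + 1)), P x) :
      ∀ᵐ x ∂m.restrict (Metric.ball c (k + 1)), P x :=
    ae_restrict_of_ae_restrict_of_subset (Metric.ball_subset_ball (by gcongr)) hn
  by_contra hcon
  rw [not_or] at hcon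
  obtain ⟨k, hk⟩ := not_forall.1 (mt (ae_of_balls _) hcon.1)
  obtain ⟨n, hn⟩ := not_forall.1 (mt (ae_of_balls _) hcon.2)
  rcases h ((max k n : ℕ) + 1) (by positivity) with h0 | h0
  · exact hk (mono (le_max_left k n) h0)
  · exact hn (mono (le_max_right k n) h0)

theorem ae_eq_zero_or_ae_ne_zero_of_discApConst_ne_top {p : ℝ} (hp : 1 < p) {v : ℂ → ℝ≥0}
    (hv : Measurable v) (h : discApConst p v ≠ ∞) : (∀ᵐ w, v w = 0) ∨ ∀ᵐ w, v w ≠ 0 := by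
  refine ae_eq_zero_or_ae_ne_zero_of_forall_ball v 0 fun r hr =>
    ae_eq_zero_or_ae_ne_zero_of_mul_ne_top hp hv (ne_top_of_le_ne_top ?_
      (setLIntegral_mul_setLIntegral_rpow_le hp.le v 0 hr))
  exact ENNReal.mul_ne_top h
    (ENNReal.rpow_ne_top_of_nonneg (by linarith) measure_ball_lt_top.ne)

theorem rpow_neg_le_two_rpow_abs_mul {ρ t : ℝ} (hρ : 0 < ρ) (h₁ : ρ / 2 ≤ t) (h₂ : t ≤ ρ)
    (a : ℝ) : t ^ (-a) ≤ 2 ^ |a| * ρ ^ (-a) := by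
  rcases le_total 0 a with ha | ha
  · calc t ^ (-a) ≤ (ρ / 2) ^ (-a) :=
          Real.rpow_le_rpow_of_nonpos (by positivity) h₁ (by linarith)
      _ = 2 ^ |a| * ρ ^ (-a) := by
          rw [Real.div_rpow hρ.le zero_le_two, Real.rpow_neg zero_le_two, div_inv_eq_mul,
            abs_of_nonneg ha, mul_comm]
  · calc t ^ (-a) ≤ ρ ^ (-a) := Real.rpow_le_rpow (by linarith) h₂ (by linarith)
      _ ≤ 2 ^ |a| * ρ ^ (-a) := le_mul_of_one_le_left (by positivity)
          (Real.one_le_rpow one_le_two (abs_nonneg a))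

/-- An upper bound for `t ^ (-a)` on the dyadic shell `R / 2 ^ (m + 1) ≤ t < R / 2 ^ m`. -/
noncomputable def dyadicRieszCoeff (a R : ℝ) (m : ℕ) : ℝ≥0∞ :=
  ENNReal.ofReal (2 ^ |a| * (R / 2 ^ m) ^ (-a))

/-- The dyadic majorant of the Riesz kernel `|w - z| ^ (-a)` on `|w - z| < R`: a combination of
the kernels of the unnormalized averages over discs of radius `R / 2 ^ m`. -/
noncomputable def dyadicRieszKernel (a R : ℝ) (z w : ℂ) : ℝ≥0∞ :=
  ∑' m : ℕ, dyadicRieszCoeff a R m * ballKernel (R / 2 ^ m) z w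

/-- The total mass of the dyadic majorant with all radii doubled. -/
noncomputable def dyadicRieszMass (a R : ℝ) : ℝ≥0∞ :=
  ∑' m : ℕ, dyadicRieszCoeff a R m * volume (Metric.ball (0 : ℂ) (2 * (R / 2 ^ m)))

theorem measurable_uncurry_dyadicRieszKernel (a R : ℝ) :
    Measurable (Function.uncurry (dyadicRieszKernel a R)) :=
  Measurable.tsum fun _ => (measurable_uncurry_ballKernel _).const_mul _

theorem exists_div_two_pow_le_lt {R t : ℝ} (ht : 0 < t) (htR : t < R) :
    ∃ m : ℕ, R / 2 ^ m / 2 ≤ t ∧ t < R / 2 ^ m := by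
  have htop : Filter.Tendsto (fun m : ℕ => R / 2 ^ m) Filter.atTop (nhds 0) :=
    tendsto_const_nhds.div_atTop (tendsto_pow_atTop_atTop_of_one_lt one_lt_two)
  have hex : ∃ m : ℕ, R / 2 ^ m ≤ t := ((htop.eventually_lt_const ht).mono fun _ => le_of_lt).exists
  obtain ⟨m, hm⟩ : ∃ m, Nat.find hex = m + 1 :=
    Nat.exists_eq_succ_of_ne_zero fun h => by simpa [htR.not_ge] using (Nat.find_eq_zero hex).1 h
  refine ⟨m, ?_, not_le.1 (Nat.find_min hex (by omega))⟩
  rw [div_div, ← pow_succ, ← hm]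
  exact Nat.find_spec hex

theorem ofReal_norm_rpow_neg_le_dyadicRieszKernel (a : ℝ) {R : ℝ} {z w : ℂ} (h : ‖w - z‖ < R) :
    ENNReal.ofReal (‖w - z‖ ^ (-a)) ≤ dyadicRieszKernel a R z w := by
  have le_of_shell (m : ℕ) (hlt : ‖w - z‖ < R / 2 ^ m)
      (hle : ‖w - z‖ ^ (-a) ≤ 2 ^ |a| * (R / 2 ^ m) ^ (-a)) :
      ENNReal.ofReal (‖w - z‖ ^ (-a)) ≤ dyadicRieszKernel a R z w := by
    refine le_trans ?_ (ENNReal.le_tsum m)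
    rw [ballKernel, Set.indicator_of_mem (mem_ball_iff_norm.2 hlt), Pi.one_apply, mul_one]
    exact ENNReal.ofReal_le_ofReal hle
  rcases (norm_nonneg (w - z)).eq_or_lt with h0 | h0
  · refine le_of_shell 0 (by simpa using h) ?_
    have hR : 0 < R := h0.trans_lt h
    rcases eq_or_ne a 0 with rfl | ha
    · simp
    · rw [← h0, Real.zero_rpow (neg_ne_zero.2 ha)]
      positivity
  · obtain ⟨m, hm, hm'⟩ := exists_div_two_pow_le_lt h0 h
    exact le_of_shell m hm' (rpow_neg_le_two_rpow_abs_mul (h0.trans hm') hm hm'.le a)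

theorem dyadicRieszMass_ne_top {a R : ℝ} (ha : a < 2) (hR : 0 < R) :
    dyadicRieszMass a R ≠ ∞ := by
  have term_eq (m : ℕ) :
      dyadicRieszCoeff a R m * volume (Metric.ball (0 : ℂ) (2 * (R / 2 ^ m))) =
        ENNReal.ofReal (2 ^ |a| * 4 * Real.pi * R ^ (2 - a) * (2 ^ (a - 2)) ^ m) := by
    set ρ := R / 2 ^ m with hρ
    have hρ0 : 0 < ρ := by positivity
    have hρ2 : ρ ^ (2 - a) = R ^ (2 - a) * (2 ^ (a - 2)) ^ m := by
      rw [hρ, Real.div_rpow hR.le (by positivity), ← Real.rpow_pow_comm zero_le_two,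
        div_eq_mul_inv, ← inv_pow, ← Real.rpow_neg zero_le_two, neg_sub]
    rw [dyadicRieszCoeff, ← hρ, Complex.volume_ball, ← ENNReal.ofReal_pow (by positivity),
      ← ENNReal.ofReal_coe_nnreal, NNReal.coe_real_pi, ← ENNReal.ofReal_mul (by positivity),
      ← ENNReal.ofReal_mul (by positivity), mul_assoc _ (R ^ _), ← hρ2, sub_eq_neg_add,
      Real.rpow_add hρ0, Real.rpow_two]
    ring_nf
  have ratio_lt_one : (2 : ℝ) ^ (a - 2) < 1 :=
    Real.rpow_lt_one_of_one_lt_of_neg one_lt_two (by linarith)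
  simp only [dyadicRieszMass, term_eq]
  exact ((summable_geometric_of_lt_one (by positivity) ratio_lt_one).mul_left _).tsum_ofReal_ne_top

theorem isBoundedKernel_dyadicRieszKernel {p : ℝ} (hp : 1 < p) {v : ℂ → ℝ≥0} (hv : Measurable v)
    (hv0 : ∀ᵐ w, v w ≠ 0) {K : ℝ≥0∞} (hK : discApConst p v ≤ K) (a : ℝ) {R : ℝ} (hR : 0 < R) :
    IsBoundedKernel p v (dyadicRieszKernel a R) (K ^ (1 / p) * dyadicRieszMass a R) := by
  have hp0 : 0 < p := by linarith
  have ball_bound (m : ℕ) : IsBoundedKernel p v (ballKernel (R / 2 ^ m))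
      (K ^ (1 / p) * volume (Metric.ball (0 : ℂ) (2 * (R / 2 ^ m)))) := by
    refine isBoundedKernel_ballKernel hp hv hv0 (by positivity) fun x => ?_
    rw [ENNReal.mul_rpow_of_nonneg _ _ hp0.le, ← ENNReal.rpow_mul, one_div_mul_cancel hp0.ne',
      ENNReal.rpow_one, ← Measure.addHaar_ball_center volume x]
    exact (setLIntegral_mul_setLIntegral_rpow_le hp.le v x (by positivity)).trans (by gcongr)
  have := IsBoundedKernel.tsum hp.le hv
    (fun m => (measurable_uncurry_ballKernel (R / 2 ^ m)).const_mul (dyadicRieszCoeff a R m))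
    fun m => (ball_bound m).const_mul hp0.le hv (measurable_uncurry_ballKernel _) _
  simp only [mul_left_comm _ (K ^ (1 / p)), ENNReal.tsum_mul_left] at this
  exact this

end OneVariable

section Slices

variable {n : ℕ} {E : Type*}

/-- The line parallel to the `j`-th axis whose remaining coordinates are `zhat`. -/
abbrev coordinateLine (j : Fin (n + 1)) (zhat : Fin n → E) (w : E) : Fin (n + 1) → E :=
  Fin.insertNth (α := fun _ => E) j w zhat

variable [MeasureSpace E]

theorem measurable_uncurry_coordinateLine (j : Fin (n + 1)) :
    Measurable fun q : (Fin n → E) × E => coordinateLine j q.1 q.2 :=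
  (MeasurableEquiv.piFinSuccAbove (fun _ : Fin (n + 1) => E) j).symm.measurable.comp
    measurable_swap

theorem measurable_coordinateLine (j : Fin (n + 1)) (zhat : Fin n → E) :
    Measurable (coordinateLine j zhat) :=
  (measurable_uncurry_coordinateLine j).comp measurable_prodMk_left

variable [SigmaFinite (volume : Measure E)]

theorem measurePreserving_uncurry_coordinateLine (j : Fin (n + 1)) :
    MeasurePreserving fun q : (Fin n → E) × E => coordinateLine j q.1 q.2 :=
  (volume_preserving_piFinSuccAbove (fun _ : Fin (n + 1) => E) j).symm.comp
    Measure.measurePreserving_swap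

theorem lintegral_eq_lintegral_coordinateLine (j : Fin (n + 1))
    {F : (Fin (n + 1) → E) → ℝ≥0∞} (hF : Measurable F) :
    ∫⁻ z, F z = ∫⁻ zhat, ∫⁻ w, F (coordinateLine j zhat w) := by
  rw [← (measurePreserving_uncurry_coordinateLine j).lintegral_comp hF]
  exact lintegral_prod _ (hF.comp (measurable_uncurry_coordinateLine j)).aemeasurable

theorem ae_coordinateLine_of_ae (j : Fin (n + 1)) {P : (Fin (n + 1) → E) → Prop}
    (hP : ∀ᵐ z, P z) : ∀ᵐ zhat, ∀ᵐ w, P (coordinateLine j zhat w) :=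
  Measure.ae_ae_of_ae_prod
    ((measurePreserving_uncurry_coordinateLine j).quasiMeasurePreserving.ae hP)

theorem ae_of_ae_coordinateLine (j : Fin (n + 1)) {P : (Fin (n + 1) → E) → Prop}
    (hPm : MeasurableSet {z | P z}) (hP : ∀ᵐ zhat, ∀ᵐ w, P (coordinateLine j zhat w)) :
    ∀ᵐ z, P z := by
  rw [← (measurePreserving_uncurry_coordinateLine j).map_eq,
    ae_map_iff (measurable_uncurry_coordinateLine j).aemeasurable hPm]
  exact (Measure.ae_prod_iff_ae_ae (measurable_uncurry_coordinateLine j hPm)).2 hP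

end Slices

section ZeroOneLaw

open scoped Pointwise

variable {n : ℕ} {G : Type*}

theorem preimage_coordinateLine_vadd [AddGroup G] (j : Fin (n + 1)) (zhat : Fin n → G) (u : G)
    (s : Set (Fin (n + 1) → G)) :
    coordinateLine j zhat ⁻¹' ((Pi.single j u : Fin (n + 1) → G) +ᵥ s) =
      u +ᵥ coordinateLine j zhat ⁻¹' s := by
  ext w
  have hline : -(Pi.single j u : Fin (n + 1) → G) + coordinateLine j zhat w =
      coordinateLine j zhat (-u + w) := by
    ext i
    refine Fin.succAboveCases j ?_ (fun i => ?_) i <;> simp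
  simp only [Set.mem_preimage, Set.mem_vadd_set_iff_neg_vadd_mem, vadd_eq_add, hline]

theorem eventuallyConst_ae_of_coordinateLine [AddCommGroup G] [MeasureSpace G] [MeasurableAdd₂ G]
    [MeasurableNeg G] [SigmaFinite (volume : Measure G)]
    [(volume : Measure G).IsAddLeftInvariant] {s : Set (Fin (n + 1) → G)} (hs : MeasurableSet s)
    (h : ∀ j, ∀ᵐ zhat, Filter.EventuallyConst (coordinateLine j zhat ⁻¹' s) (ae volume)) :
    Filter.EventuallyConst s (ae volume) := by
  have single_mem (j : Fin (n + 1)) (u : G) :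
      Pi.single j u ∈ AddAction.aestabilizer (Fin (n + 1) → G) volume s := by
    rw [AddAction.mem_aestabilizer, Filter.eventuallyEq_set]
    refine ae_of_ae_coordinateLine j ((hs.const_vadd _).mem.iff hs.mem).setOf ?_
    filter_upwards [h j] with zhat hconst
    have slice_mem : u ∈ AddAction.aestabilizer G volume (coordinateLine j zhat ⁻¹' s) := by
      rcases Filter.eventuallyConst_set'.1 hconst with hnull | hnull <;>
        simp [AddAction.aestabilizer_congr hnull]
    rw [AddAction.mem_aestabilizer, ← preimage_coordinateLine_vadd,
      Filter.eventuallyEq_set] at slice_mem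
    exact slice_mem
  refine AddAction.aeconst_of_aestabilizer_eq_top (G := Fin (n + 1) → G) hs.nullMeasurableSet
    (top_unique fun u _ => ?_)
  rw [← Finset.univ_sum_single u]
  exact sum_mem fun j _ => single_mem j (u j)

end ZeroOneLaw

section Tensorization

variable {E : Type*} [MeasureSpace E]

/-- The operator with kernel `k` acting in the `j`-th variable. -/
noncomputable def coordinateKernelOperator {ι : Type*} [DecidableEq ι] (k : E → E → ℝ≥0∞) (j : ι)
    (g : (ι → E) → ℝ≥0∞) (z : ι → E) : ℝ≥0∞ :=
  kernelOperator k (fun w => g (Function.update z j w)) (z j)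

/-- The operator with the product kernel `∏ i ∈ s, k i`, acting in the variables indexed
by `s`. -/
noncomputable def partialKernelOperator {ι : Type*} [DecidableEq ι] (k : ι → E → E → ℝ≥0∞)
    (s : Finset ι) (g : (ι → E) → ℝ≥0∞) (z : ι → E) : ℝ≥0∞ :=
  lmarginal (fun _ => volume) s (fun ζ => (∏ i ∈ s, k i (z i) (ζ i)) * g ζ) z

section PartialKernel

variable {ι : Type*} [DecidableEq ι]

theorem partialKernelOperator_empty (k : ι → E → E → ℝ≥0∞) (g : (ι → E) → ℝ≥0∞) :
    partialKernelOperator k ∅ g = g := by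
  ext z
  simp only [partialKernelOperator, Finset.prod_empty, one_mul, lmarginal_empty]

variable [SigmaFinite (volume : Measure E)]

theorem partialKernelOperator_univ [Fintype ι] (k : ι → E → E → ℝ≥0∞) (g : (ι → E) → ℝ≥0∞) :
    partialKernelOperator k Finset.univ g =
      kernelOperator (fun z ζ => ∏ i, k i (z i) (ζ i)) g := by
  ext z
  rw [partialKernelOperator, lmarginal_univ]
  rfl

theorem measurable_coordinateKernelOperator {k : E → E → ℝ≥0∞}
    (hk : Measurable (Function.uncurry k)) (j : ι) {g : (ι → E) → ℝ≥0∞} (hg : Measurable g) :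
    Measurable (coordinateKernelOperator k j g) := by
  have hkq : Measurable fun q : (ι → E) × E => k (q.1 j) q.2 := by fun_prop
  exact (hkq.mul (hg.comp measurable_update')).lintegral_prod_right'

theorem partialKernelOperator_insert {k : ι → E → E → ℝ≥0∞}
    (hk : ∀ i, Measurable (Function.uncurry (k i))) {s : Finset ι} {i : ι} (hi : i ∉ s)
    {g : (ι → E) → ℝ≥0∞} (hg : Measurable g) :
    partialKernelOperator k (insert i s) g =
      coordinateKernelOperator (k i) i (partialKernelOperator k s g) := by
  have integrand_measurable (t : Finset ι) (z : ι → E) :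
      Measurable fun ζ : ι → E => (∏ l ∈ t, k l (z l) (ζ l)) * g ζ :=
    (Finset.measurable_fun_prod _ fun l _ =>
      (hk l).of_uncurry_left.comp (measurable_pi_apply l)).mul hg
  ext z
  rw [partialKernelOperator, lmarginal_insert _ (integrand_measurable _ z) hi]
  refine lintegral_congr fun w => ?_
  simp only [partialKernelOperator, lmarginal]
  rw [← lintegral_const_mul]
  · refine lintegral_congr fun y => ?_
    have coord_i : Function.updateFinset (Function.update z i w) s y i = w := by
      simp [Function.updateFinset, hi]
    have coord_ne (l : ι) (hl : l ∈ s) : Function.update z i w l = z l :=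
      Function.update_of_ne (ne_of_mem_of_not_mem hl hi) w z
    rw [Finset.prod_insert hi, coord_i, mul_assoc]
    congr 2
    exact Finset.prod_congr rfl fun l hl => by rw [coord_ne l hl]
  · exact (integrand_measurable s _).comp measurable_updateFinset

theorem measurable_partialKernelOperator {k : ι → E → E → ℝ≥0∞}
    (hk : ∀ i, Measurable (Function.uncurry (k i))) (s : Finset ι) {g : (ι → E) → ℝ≥0∞}
    (hg : Measurable g) : Measurable (partialKernelOperator k s g) := by
  induction s using Finset.induction_on with
  | empty => rwa [partialKernelOperator_empty]
  | insert i s hi ih =>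
    rw [partialKernelOperator_insert hk hi hg]
    exact measurable_coordinateKernelOperator (hk i) i ih

end PartialKernel

variable [SigmaFinite (volume : Measure E)] {n : ℕ} {p : ℝ} {μ : (Fin (n + 1) → E) → ℝ≥0}

theorem lintegral_coordinateKernelOperator_rpow_mul_le (hμ : Measurable μ) {k : E → E → ℝ≥0∞}
    (hkm : Measurable (Function.uncurry k)) (j : Fin (n + 1)) {C : ℝ≥0∞}
    (hk : ∀ᵐ zhat, IsBoundedKernel p (μ ∘ coordinateLine j zhat) k C)
    {g : (Fin (n + 1) → E) → ℝ≥0∞} (hg : Measurable g) :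
    ∫⁻ z, coordinateKernelOperator k j g z ^ p * μ z ≤ C ^ p * ∫⁻ z, g z ^ p * μ z := by
  have hT : Measurable fun z => coordinateKernelOperator k j g z ^ p * μ z :=
    ((measurable_coordinateKernelOperator hkm j hg).pow_const p).mul hμ.coe_nnreal_ennreal
  have hgμ : Measurable fun z => g z ^ p * μ z := (hg.pow_const p).mul hμ.coe_nnreal_ennreal
  have hslice : Measurable fun zhat => ∫⁻ w, g (coordinateLine j zhat w) ^ p *
      μ (coordinateLine j zhat w) :=
    (hgμ.comp (measurable_uncurry_coordinateLine j)).lintegral_prod_right'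
  rw [lintegral_eq_lintegral_coordinateLine j hT, lintegral_eq_lintegral_coordinateLine j hgμ,
    ← lintegral_const_mul _ hslice]
  refine lintegral_mono_ae ?_
  filter_upwards [hk] with zhat hzhat
  have := hzhat (hg.comp (measurable_coordinateLine j zhat))
  simpa only [coordinateKernelOperator, coordinateLine, Fin.insertNth_apply_same,
    Fin.update_insertNth, Function.comp_def] using this

theorem isBoundedKernel_prod (hp : 0 ≤ p) (hμ : Measurable μ) {k : Fin (n + 1) → E → E → ℝ≥0∞}
    (hkm : ∀ j, Measurable (Function.uncurry (k j))) {C : Fin (n + 1) → ℝ≥0∞}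
    (hk : ∀ j, ∀ᵐ zhat, IsBoundedKernel p (μ ∘ coordinateLine j zhat) (k j) (C j)) :
    IsBoundedKernel p μ (fun z ζ => ∏ j, k j (z j) (ζ j)) (∏ j, C j) := by
  intro g hg
  have partial_bound (s : Finset (Fin (n + 1))) :
      ∫⁻ z, partialKernelOperator k s g z ^ p * μ z ≤
        (∏ j ∈ s, C j) ^ p * ∫⁻ z, g z ^ p * μ z := by
    induction s using Finset.induction_on with
    | empty => simp only [partialKernelOperator_empty, Finset.prod_empty, ENNReal.one_rpow,
        one_mul, le_refl]
    | insert i s hi ih =>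
      rw [partialKernelOperator_insert hkm hi hg, Finset.prod_insert hi,
        ENNReal.mul_rpow_of_nonneg _ _ hp, mul_assoc]
      refine (lintegral_coordinateKernelOperator_rpow_mul_le hμ (hkm i) i (hk i)
        (measurable_partialKernelOperator hkm s hg)).trans ?_
      gcongr
  rw [← partialKernelOperator_univ]
  exact partial_bound Finset.univ

end Tensorization

section DominatedOperator

variable {X F : Type*} [MeasureSpace X] [NormedAddCommGroup F] {p : ℝ} {v : X → ℝ≥0}
  {k : X → X → ℝ≥0∞} {C : ℝ≥0∞} {Ω : Set X}

theorem IsBoundedKernel.congr_weight {v' : X → ℝ≥0} (hvv' : v =ᵐ[volume] v')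
    (hk : IsBoundedKernel p v k C) : IsBoundedKernel p v' k C := by
  have lintegral_congr_weight (u : X → ℝ≥0∞) : ∫⁻ z, u z * v' z = ∫⁻ z, u z * v z :=
    lintegral_congr_ae (hvv'.mono fun z hz => by simp only [hz])
  intro g hg
  rw [lintegral_congr_weight, lintegral_congr_weight]
  exact hk hg

theorem IsBoundedKernel.eLpNorm_kernelOperator_indicator_le (hp : 0 < p) (hv : AEMeasurable v)
    (hk : IsBoundedKernel p v k C) (hΩ : MeasurableSet Ω) {g : X → ℝ≥0∞}
    (hg : AEMeasurable g (volume.restrict Ω)) :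
    eLpNorm (kernelOperator k (Ω.indicator g)) (ENNReal.ofReal p)
        ((volume.restrict Ω).withDensity fun z => v z) ≤
      C * eLpNorm g (ENNReal.ofReal p) ((volume.restrict Ω).withDensity fun z => v z) := by
  have lintegral_eq (u : X → ℝ≥0∞) :
      ∫⁻ z, u z ∂((volume.restrict Ω).withDensity fun z => v z) = ∫⁻ z in Ω, u z * v z := by
    rw [lintegral_withDensity_eq_lintegral_mul_non_measurable₀ _
      hv.restrict.coe_nnreal_ennreal (.of_forall fun _ => ENNReal.coe_lt_top)]
    simp only [Pi.mul_apply, mul_comm]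
  have indicator_eq : ∫⁻ z, Ω.indicator g z ^ p * v z = ∫⁻ z in Ω, g z ^ p * v z := by
    rw [← lintegral_indicator hΩ]
    refine lintegral_congr fun z => ?_
    by_cases hz : z ∈ Ω <;> simp [hz, ENNReal.zero_rpow_of_pos hp]
  obtain ⟨h, hh, hgh⟩ := (aemeasurable_indicator_iff hΩ).2 hg
  have hgh' : ∫⁻ z, Ω.indicator g z ^ p * v z = ∫⁻ z, h z ^ p * v z :=
    lintegral_congr_ae (hgh.mono fun z hz => by simp only [hz])
  simp only [eLpNorm_eq_lintegral_rpow_enorm_toReal (ENNReal.ofReal_pos.2 hp).ne'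
    ENNReal.ofReal_ne_top, ENNReal.toReal_ofReal hp.le, enorm_eq_self, lintegral_eq]
  rw [one_div, ENNReal.rpow_inv_le_iff hp, ENNReal.mul_rpow_of_nonneg _ _ hp.le,
    ENNReal.rpow_inv_rpow hp.ne', ← indicator_eq, hgh', kernelOperator_congr_ae k hgh]
  exact (setLIntegral_le_lintegral _ _).trans (hk hh)

variable {Φ : X → X → F} {f : X → F}

theorem setLIntegral_enorm_le_kernelOperator (hΩ : MeasurableSet Ω)
    (hΦ : ∀ z ∈ Ω, ∀ ζ ∈ Ω, ‖Φ z ζ‖ₑ ≤ k z ζ * ‖f ζ‖ₑ) {z : X} (hz : z ∈ Ω) :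
    ∫⁻ ζ in Ω, ‖Φ z ζ‖ₑ ≤ kernelOperator k (Ω.indicator fun ζ => ‖f ζ‖ₑ) z := by
  rw [kernelOperator, ← lintegral_indicator hΩ]
  refine lintegral_mono fun ζ => ?_
  by_cases hζ : ζ ∈ Ω
  · simpa only [Set.indicator_of_mem hζ] using hΦ z hz ζ hζ
  · simp only [Set.indicator_of_notMem hζ, mul_zero, le_refl]

theorem IsBoundedKernel.eLpNorm_setIntegral_le [NormedSpace ℝ F] (hp : 0 < p)
    (hv : AEMeasurable v) (hk : IsBoundedKernel p v k C) (hΩ : MeasurableSet Ω)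
    (hΦ : ∀ z ∈ Ω, ∀ ζ ∈ Ω, ‖Φ z ζ‖ₑ ≤ k z ζ * ‖f ζ‖ₑ)
    (hf : AEStronglyMeasurable f (volume.restrict Ω)) :
    eLpNorm (fun z => ∫ ζ in Ω, Φ z ζ) (ENNReal.ofReal p)
        ((volume.restrict Ω).withDensity fun z => v z) ≤
      C * eLpNorm f (ENNReal.ofReal p) ((volume.restrict Ω).withDensity fun z => v z) := by
  rw [← eLpNorm_enorm f]
  refine le_trans (eLpNorm_mono_enorm_ae ?_)
    (hk.eLpNorm_kernelOperator_indicator_le hp hv hΩ hf.enorm)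
  filter_upwards [(withDensity_absolutelyContinuous _ _).ae_le (ae_restrict_mem hΩ)] with z hz
  exact (enorm_integral_le_lintegral_enorm _).trans (setLIntegral_enorm_le_kernelOperator hΩ hΦ hz)

theorem restrict_absolutelyContinuous_withDensity (hv : AEMeasurable v) (hv0 : ∀ᵐ z, v z ≠ 0)
    (Ω : Set X) : volume.restrict Ω ≪ (volume.restrict Ω).withDensity fun z => v z :=
  withDensity_absolutelyContinuous' hv.restrict.coe_nnreal_ennreal
    ((ae_restrict_of_ae hv0).mono fun _ hz => ENNReal.coe_ne_zero.2 hz)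

theorem IsBoundedKernel.ae_integrableOn [SFinite (volume : Measure X)] (hp : 0 < p)
    (hv : AEMeasurable v) (hv0 : ∀ᵐ z, v z ≠ 0) (hkm : Measurable (Function.uncurry k))
    (hk : IsBoundedKernel p v k C) (hC : C ≠ ∞) (hΩ : MeasurableSet Ω)
    (hΦ : ∀ z ∈ Ω, ∀ ζ ∈ Ω, ‖Φ z ζ‖ₑ ≤ k z ζ * ‖f ζ‖ₑ)
    (hΦm : ∀ z, AEStronglyMeasurable (Φ z) (volume.restrict Ω))
    (hf : MemLp f (ENNReal.ofReal p) ((volume.restrict Ω).withDensity fun z => v z)) :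
    ∀ᵐ z ∂(volume.restrict Ω), IntegrableOn (Φ z) Ω := by
  have hac := restrict_absolutelyContinuous_withDensity hv hv0 Ω
  have hfm : AEMeasurable (fun ζ => ‖f ζ‖ₑ) (volume.restrict Ω) :=
    (hf.aestronglyMeasurable.mono_ac hac).enorm
  set T := kernelOperator k (Ω.indicator fun ζ => ‖f ζ‖ₑ)
  have hT : Measurable T := by
    obtain ⟨h, hh, hfh⟩ := (aemeasurable_indicator_iff hΩ).2 hfm
    simpa only [T, kernelOperator_congr_ae k hfh] using measurable_kernelOperator hkm hh
  have norm_lt_top :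
      eLpNorm T (ENNReal.ofReal p) ((volume.restrict Ω).withDensity fun z => v z) < ∞ :=
    (hk.eLpNorm_kernelOperator_indicator_le hp hv hΩ hfm).trans_lt
      (ENNReal.mul_lt_top hC.lt_top ((eLpNorm_enorm f).trans_lt hf.eLpNorm_lt_top))
  have rpow_lt_top := ae_lt_top (hT.enorm.pow_const _)
    (lintegral_rpow_enorm_lt_top_of_eLpNorm_lt_top (ENNReal.ofReal_pos.2 hp).ne'
      ENNReal.ofReal_ne_top norm_lt_top).ne
  filter_upwards [hac.ae_le rpow_lt_top, ae_restrict_mem hΩ] with z hz hzΩ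
  rw [ENNReal.toReal_ofReal hp.le, ENNReal.rpow_lt_top_iff_of_pos hp] at hz
  exact ⟨hΦm z, (setLIntegral_enorm_le_kernelOperator hΩ hΦ hzΩ).trans_lt hz⟩

end DominatedOperator

section ApStar

variable {n : ℕ} {p : ℝ}

theorem discApConst_congr {v v' : ℂ → ℝ≥0} (h : v =ᵐ[volume] v') :
    discApConst p v = discApConst p v' := by
  have average_congr (φ : ℝ≥0 → ℝ≥0∞) (c : ℂ) (r : ℝ) :
      ⨍⁻ w in Metric.ball c r, φ (v w) ∂volume = ⨍⁻ w in Metric.ball c r, φ (v' w) ∂volume :=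
    laverage_congr ((ae_restrict_of_ae h).mono fun _ hw => congrArg φ hw)
  simp only [discApConst, discApQuantity, average_congr (fun x => x),
    average_congr fun x => (x : ℝ≥0∞) ^ (1 / (1 - p))]

theorem apStarConst_congr {μ μ' : (Fin (n + 1) → ℂ) → ℝ≥0} (h : μ =ᵐ[volume] μ') :
    apStarConst p μ = apStarConst p μ' :=
  iSup_congr fun j => essSup_congr_ae <| (ae_coordinateLine_of_ae j h).mono fun _ hslice =>
    discApConst_congr hslice

theorem ae_discApConst_weightSlice_le (μ : (Fin (n + 1) → ℂ) → ℝ≥0) (j : Fin (n + 1)) :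
    ∀ᵐ zhat, discApConst p (weightSlice μ j zhat) ≤ apStarConst p μ :=
  (ENNReal.ae_le_essSup fun zhat => discApConst p (weightSlice μ j zhat)).mono fun _ h =>
    h.trans (le_iSup_of_le j le_rfl)

variable {μ : (Fin (n + 1) → ℂ) → ℝ≥0}

theorem MemApStar.congr {μ' : (Fin (n + 1) → ℂ) → ℝ≥0} (hμ : MemApStar p μ)
    (h : μ =ᵐ[volume] μ') : MemApStar p μ' where
  aemeasurable := hμ.aemeasurable.congr h
  not_ae_zero h0 := hμ.not_ae_zero (h.trans h0)
  const_lt_top := apStarConst_congr (p := p) h ▸ hμ.const_lt_top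

theorem MemApStar.ae_ne_zero (hp : 1 < p) (hμ : MemApStar p μ) : ∀ᵐ z, μ z ≠ 0 := by
  wlog hm : Measurable μ generalizing μ
  · obtain ⟨ν, hν, hμν⟩ := hμ.aemeasurable
    filter_upwards [this (hμ.congr hμν) hν, hμν] with z hz heq
    rwa [heq]
  have zero_set_const : Filter.EventuallyConst {z | μ z = 0} (ae volume) := by
    refine eventuallyConst_ae_of_coordinateLine (hm (measurableSet_singleton 0)) fun j => ?_
    filter_upwards [ae_discApConst_weightSlice_le μ j] with zhat hle
    exact Filter.eventuallyConst_set.2 (ae_eq_zero_or_ae_ne_zero_of_discApConst_ne_top hp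
      (hm.comp (measurable_coordinateLine j zhat)) (hle.trans_lt hμ.const_lt_top).ne)
  exact (Filter.eventuallyConst_set.1 zero_set_const).resolve_left hμ.not_ae_zero

/-- The product of the dyadic majorants of the kernels `|ζ_j - z_j| ^ (-α_j)`. -/
noncomputable def dyadicRieszProductKernel {n : ℕ} (α : Fin n → ℝ) (R : ℝ) (z ζ : Fin n → ℂ) :
    ℝ≥0∞ :=
  ∏ j, dyadicRieszKernel (α j) R (z j) (ζ j)

theorem measurable_uncurry_dyadicRieszProductKernel {n : ℕ} (α : Fin n → ℝ) (R : ℝ) :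
    Measurable (Function.uncurry (dyadicRieszProductKernel α R)) := by
  have factor_measurable (j : Fin n) : Measurable fun q : (Fin n → ℂ) × (Fin n → ℂ) =>
      dyadicRieszKernel (α j) R (q.1 j) (q.2 j) := by
    have := measurable_uncurry_dyadicRieszKernel (α j) R
    fun_prop
  exact Finset.measurable_fun_prod Finset.univ fun j _ => factor_measurable j

theorem MemApStar.isBoundedKernel (hp : 1 < p) (hμ : MemApStar p μ) {K : ℝ≥0∞}
    (hK : apStarConst p μ ≤ K) (α : Fin (n + 1) → ℝ) {R : ℝ} (hR : 0 < R) :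
    IsBoundedKernel p μ (dyadicRieszProductKernel α R)
      (∏ j, K ^ (1 / p) * dyadicRieszMass (α j) R) := by
  wlog hm : Measurable μ generalizing μ
  · obtain ⟨ν, hν, hμν⟩ := hμ.aemeasurable
    exact (this (hμ.congr hμν) (apStarConst_congr (p := p) hμν ▸ hK) hν).congr_weight hμν.symm
  refine isBoundedKernel_prod (by linarith) hm
    (fun j => measurable_uncurry_dyadicRieszKernel (α j) R) fun j => ?_
  filter_upwards [ae_discApConst_weightSlice_le μ j,
    ae_coordinateLine_of_ae j (hμ.ae_ne_zero hp)] with zhat hle hne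
  exact isBoundedKernel_dyadicRieszKernel hp (hm.comp (measurable_coordinateLine j zhat)) hne
    (hle.trans hK) (α j) hR

end ApStar

section RieszIntegral

variable {n : ℕ} {α : Fin n → ℝ} {Ω : Set (Fin n → ℂ)} {f : (Fin n → ℂ) → ℂ}

theorem enorm_rieszIntegrand_le (α : Fin n → ℝ) {R : ℝ} (f : (Fin n → ℂ) → ℂ) {z ζ : Fin n → ℂ}
    (h : dist ζ z < R) :
    ‖rieszIntegrand α f z ζ‖ₑ ≤ dyadicRieszProductKernel α R z ζ * ‖f ζ‖ₑ := by
  have norm_eq : ‖rieszIntegrand α f z ζ‖ = (∏ j, ‖ζ j - z j‖ ^ (-α j)) * ‖f ζ‖ := by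
    have prod_nonneg : 0 ≤ ∏ j, ‖ζ j - z j‖ ^ α j := Finset.prod_nonneg fun j _ => by positivity
    simp only [Real.rpow_neg (norm_nonneg _), Finset.prod_inv_distrib]
    rw [rieszIntegrand, norm_div, Complex.norm_real, Real.norm_of_nonneg prod_nonneg,
      div_eq_inv_mul]
  rw [← ofReal_norm, norm_eq, ENNReal.ofReal_mul (Finset.prod_nonneg fun j _ => by positivity),
    ofReal_norm, ENNReal.ofReal_prod_of_nonneg fun j _ => by positivity]
  refine mul_le_mul_left (Finset.prod_le_prod' fun j _ => ?_) _
  refine ofReal_norm_rpow_neg_le_dyadicRieszKernel (α j) (lt_of_le_of_lt ?_ h)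
  rw [← dist_eq_norm]
  exact dist_le_pi_dist ζ z j

theorem aestronglyMeasurable_uncurry_rieszIntegrand (α : Fin n → ℝ)
    (hf : AEStronglyMeasurable f (volume.restrict Ω)) :
    AEStronglyMeasurable (Function.uncurry (rieszIntegrand α f))
      ((volume.restrict Ω).prod (volume.restrict Ω)) := by
  have hker : Measurable fun q : (Fin n → ℂ) × (Fin n → ℂ) =>
      ((∏ j, ‖q.2 j - q.1 j‖ ^ α j : ℝ) : ℂ)⁻¹ := by fun_prop
  exact hf.comp_snd.mul hker.aestronglyMeasurable

theorem aestronglyMeasurable_rieszIntegrand (α : Fin n → ℝ)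
    (hf : AEStronglyMeasurable f (volume.restrict Ω)) (z : Fin n → ℂ) :
    AEStronglyMeasurable (rieszIntegrand α f z) (volume.restrict Ω) := by
  have hker : Measurable fun ζ : Fin n → ℂ => ((∏ j, ‖ζ j - z j‖ ^ α j : ℝ) : ℂ)⁻¹ := by fun_prop
  exact hf.mul hker.aestronglyMeasurable

theorem aestronglyMeasurable_rieszIntegral (α : Fin n → ℝ)
    (hf : AEStronglyMeasurable f (volume.restrict Ω)) :
    AEStronglyMeasurable (rieszIntegral Ω α f) (volume.restrict Ω) :=
  (aestronglyMeasurable_uncurry_rieszIntegrand α hf).integral_prod_right'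

end RieszIntegral

theorem theorem2p3_general {n : ℕ} {Ω : Set (Fin (n + 1) → ℂ)} (hΩ : MeasurableSet Ω)
    (hΩb : Bornology.IsBounded Ω) {α : Fin (n + 1) → ℝ} (hα : ∀ j, α j < 2) {p : ℝ} (hp : 1 < p)
    (K : ℝ≥0) :
    ∃ C : ℝ≥0, ∀ μ : (Fin (n + 1) → ℂ) → ℝ≥0, MemApStar p μ → apStarConst p μ ≤ K →
      ∀ f : (Fin (n + 1) → ℂ) → ℂ,
        MemLp f (ENNReal.ofReal p) (weightedVolume Ω μ) →
          (∀ᵐ z ∂(volume.restrict Ω), IntegrableOn (rieszIntegrand α f z) Ω volume) ∧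
          MemLp (rieszIntegral Ω α f) (ENNReal.ofReal p) (weightedVolume Ω μ) ∧
          eLpNorm (rieszIntegral Ω α f) (ENNReal.ofReal p) (weightedVolume Ω μ) ≤
            C * eLpNorm f (ENNReal.ofReal p) (weightedVolume Ω μ) := by
  have hp0 : 0 < p := by linarith
  have hR : 0 < Metric.diam Ω + 1 := by linarith [Metric.diam_nonneg (s := Ω)]
  set R := Metric.diam Ω + 1
  have hC : ∏ j, (K : ℝ≥0∞) ^ (1 / p) * dyadicRieszMass (α j) R ≠ ∞ :=
    ENNReal.prod_ne_top fun j _ => ENNReal.mul_ne_top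
      (ENNReal.rpow_ne_top_of_nonneg (by positivity) ENNReal.coe_ne_top)
      (dyadicRieszMass_ne_top (hα j) hR)
  refine ⟨(∏ j, (K : ℝ≥0∞) ^ (1 / p) * dyadicRieszMass (α j) R).toNNReal, fun μ hμ hK f hf => ?_⟩
  rw [ENNReal.coe_toNNReal hC]
  have hbounded := hμ.isBoundedKernel hp hK α hR
  have hfm := hf.aestronglyMeasurable.mono_ac
    (restrict_absolutelyContinuous_withDensity hμ.aemeasurable (hμ.ae_ne_zero hp) Ω)
  have dominated (z) (hz : z ∈ Ω) (ζ) (hζ : ζ ∈ Ω) := enorm_rieszIntegrand_le α f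
    (lt_add_of_le_of_pos (Metric.dist_le_diam_of_mem hΩb hζ hz) one_pos)
  have norm_le := hbounded.eLpNorm_setIntegral_le hp0 hμ.aemeasurable hΩ dominated hfm
  exact ⟨hbounded.ae_integrableOn hp0 hμ.aemeasurable (hμ.ae_ne_zero hp)
      (measurable_uncurry_dyadicRieszProductKernel α R) hC hΩ dominated
      (aestronglyMeasurable_rieszIntegrand α hfm) hf,
    ⟨(aestronglyMeasurable_rieszIntegral α hfm).mono_ac (withDensity_absolutelyContinuous _ _),
      norm_le.trans_lt (ENNReal.mul_lt_top hC.lt_top hf.eLpNorm_lt_top)⟩, norm_le⟩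

theorem theorem2p3 {n : ℕ} (D : Fin (n + 1) → Set ℂ)
    (hDopen : ∀ j, IsOpen (D j)) (hDconn : ∀ j, IsConnected (D j))
    (hDbdd : ∀ j, Bornology.IsBounded (D j))
    (α : Fin (n + 1) → ℝ) (hα : ∀ j, 0 < α j ∧ α j < 2)
    (p : ℝ) (hp : 1 < p) (K : ℝ≥0) :
    ∃ C : ℝ≥0, ∀ μ : (Fin (n + 1) → ℂ) → ℝ≥0, MemApStar p μ → apStarConst p μ ≤ K →
      ∀ f : (Fin (n + 1) → ℂ) → ℂ,
        MemLp f (ENNReal.ofReal p) (weightedVolume (Set.univ.pi D) μ) →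
          (∀ᵐ z ∂(volume.restrict (Set.univ.pi D)),
            IntegrableOn (rieszIntegrand α f z) (Set.univ.pi D) volume) ∧
          MemLp (rieszIntegral (Set.univ.pi D) α f) (ENNReal.ofReal p)
            (weightedVolume (Set.univ.pi D) μ) ∧
          eLpNorm (rieszIntegral (Set.univ.pi D) α f) (ENNReal.ofReal p)
              (weightedVolume (Set.univ.pi D) μ) ≤
            C * eLpNorm f (ENNReal.ofReal p) (weightedVolume (Set.univ.pi D) μ) :=
  theorem2p3_general
    (isOpen_set_pi Set.finite_univ fun j _ => hDopen j).measurableSet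
    (Bornology.IsBounded.pi hDbdd) (fun j => (hα j).2) hp K
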